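/- Let $\mathfrak g$ be a three-dimensional real Lie algebra (a Bianchi type) with a basis $b_1,b_2,b_3$ and structure constants $C^\alpha_{\beta\gamma}$, $[b_\beta,b_\gamma]=C^\alpha_{\beta\gamma}b_\alpha$ (repeated indices are summed over $1,2,3$). Let $U\subseteq\mathbb R^3$ be a nonempty open set (the coordinate domain of a Bianchi-homogeneous 3-space) carrying an invariant basis of one-forms of this type: smooth, pointwise linearly independent one-forms $\sigma^\alpha=\sigma^\alpha_i(x)\,dx^i$ on $U$ with $d\sigma^\alpha=C^\alpha_{\beta\gamma}\,\sigma^\beta\wedge\sigma^\gamma$, that is, $$\partial_j\sigma^\alpha_i-\partial_i\sigma^\alpha_j=2C^\alpha_{\beta\gamma}\sigma^\gamma_i\sigma^\beta_j .$$ Write $\sigma^i_\alpha$ for the inverse matrix of $\sigma^\alpha_i$. Let $\Lambda\in GL(3,\mathbb R)$ be a constant matrix and $S=\Lambda^{-1}$. A coordinate change in $U$ is a smooth diffeomorphism $f$ from an open subset of $U$ onto an open subset of $U$. It transforms the one-forms into $\tilde\sigma^\alpha_m(\tilde x)=\sigma^\alpha_i(x)\,\partial x^i/\partial\tilde x^m$,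 $\tilde x=f(x)$; we say that $f$ mixes the one-forms by $\Lambda$ if $\tilde\sigma^\alpha_m(\tilde x)=\Lambda^\alpha_\mu\,\sigma^\mu_m(\tilde x)$ for all $\tilde x$ in the image of $f$. Then: 1. A coordinate change $f$ in $U$ mixes the one-forms by $\Lambda$ if and only if on its domain $$\frac{\partial f^i}{\partial x^j}(x)=\sigma^i_\alpha(f(x))\,S^\alpha_\beta\,\sigma^\beta_j(x).\qquad(*)$$ 2. The expression $\partial_k\partial_lf^i-\partial_l\partial_kf^i$ which $(*)$ prescribes, by differentiating $(*)$ with the chain rule and substituting $(*)$ for the first derivatives of $f$, at an arbitrary point $x\in U$ for an arbitrary value $f(x)=y\in U$, equals $$2\,\sigma^i_\alpha(y)\,\sigma^\epsilon_k(x)\,\sigma^\delta_l(x)\left(C^\rho_{\epsilon\delta}S^\alpha_\rho-C^\alpha_{\mu\nu}S^\mu_\epsilon S^\nu_\delta\right).$$ 3. The following are equivalent: (a) there is a coordinate change in $U$, with nonempty domain, that mixes the one-forms by $\Lambda$; (b) for all $x_0,y_0\in U$ there is a coordinate change $f$ in $U$, defined near $x_0$, with $f(x_0)=y_0$, that mixes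 the one-forms by $\Lambda$; (c) $(*)$ has a differentiable solution $f:V\to U$ on some nonempty open set $V\subseteq U$; (d) the integrability condition of $(*)$ holds: the expression in 2 vanishes for all $x,y\in U$ and all $i,k,l$; (e) $S$ is the matrix of a Lie algebra automorphism of $\mathfrak g$ in the basis $b$ (that is, $b_\mu\mapsto S^\alpha_\mu b_\alpha$ defines one); (f) $\Lambda$ is the matrix of a Lie algebra automorphism of $\mathfrak g$ in the basis $b$; (g) $C^\rho_{\mu\nu}\Lambda^\alpha_\rho=\Lambda^\kappa_\mu\Lambda^\lambda_\nu C^\alpha_{\kappa\lambda}$ for all $\alpha,\mu,\nu$. -/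

import Mathlib

open scoped ContDiff

noncomputable section

namespace Bianchi

/-- Coordinate triples `x = (x⁰, x¹, x²)`. Only the topology and the smooth structure of `ℝ³` are
used below, so the choice of norm plays no role. -/
abbrev Coord : Type := Fin 3 → ℝ

/-- The partial derivative `∂g/∂xʲ` at `x`. -/
def pd (j : Fin 3) (g : Coord → ℝ) (x : Coord) : ℝ :=
  fderiv ℝ g x (Pi.single j 1)

/-- The Jacobian matrix `∂gⁱ/∂xʲ` (row `i`, column `j`) at `x`. -/
def jacobian (g : Coord → Coord) (x : Coord) : Matrix (Fin 3) (Fin 3) ℝ :=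
  Matrix.of fun i j => pd j (fun z => g z i) x

/-- The structure constants `C^α_{βγ}` of a three-dimensional real Lie algebra in the basis `b`:
`[b_β, b_γ] = ∑_α C^α_{βγ} b_α`. -/
def structureConst {𝔤 : Type*} [LieRing 𝔤] [LieAlgebra ℝ 𝔤] (b : Module.Basis (Fin 3) ℝ 𝔤)
    (α β γ : Fin 3) : ℝ :=
  b.repr ⁅b β, b γ⁆ α

/-- The matrix `L` is the matrix, in the basis `b`, of an automorphism of the Lie algebra:
`φ(b_μ) = ∑_α L^α_μ b_α`. -/
def IsLieAutomorphism {𝔤 : Type*} [LieRing 𝔤] [LieAlgebra ℝ 𝔤] (b : Module.Basis (Fin 3) ℝ 𝔤)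
    (L : Matrix (Fin 3) (Fin 3) ℝ) : Prop :=
  ∃ φ : 𝔤 ≃ₗ⁅ℝ⁆ 𝔤, ∀ μ, φ (b μ) = ∑ α, L α μ • b α

/-- The one-forms `σ^α = ∑ᵢ σ^α_i(x) dxⁱ` (with `σ^α_i(x) = σ x α i`) are an invariant basis on
`U` with constants `C`: they are smooth and pointwise linearly independent, and
`dσ^α = ∑_{β,γ} C^α_{βγ} σ^β ∧ σ^γ`, which in components reads
`∂_j σ^α_i - ∂_i σ^α_j = 2 ∑_{β,γ} C^α_{βγ} σ^γ_i σ^β_j`. -/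
structure IsInvariantBasis (C : Fin 3 → Fin 3 → Fin 3 → ℝ) (U : Set Coord)
    (σ : Coord → Matrix (Fin 3) (Fin 3) ℝ) : Prop where
  smooth : ∀ α i, ContDiffOn ℝ ∞ (fun x => σ x α i) U
  nonsingular : ∀ x ∈ U, (σ x).det ≠ 0
  structure_equation : ∀ x ∈ U, ∀ α i j,
    pd j (fun z => σ z α i) x - pd i (fun z => σ z α j) x
      = 2 * ∑ β, ∑ γ, C α β γ * σ x γ i * σ x β j

/-- A (local) change of coordinates `x ↦ f x` inside `U`: a smooth diffeomorphism from an open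
subset of `U` onto an open subset of `U`. -/
structure IsCoordChange (U : Set Coord) (f : OpenPartialHomeomorph Coord Coord) : Prop where
  source_subset : f.source ⊆ U
  target_subset : f.target ⊆ U
  smooth : ContDiffOn ℝ ∞ f f.source
  smooth_symm : ContDiffOn ℝ ∞ f.symm f.target

/-- The components `σ̃^α_m(y) = ∑ᵢ σ^α_i(x) ∂xⁱ/∂yᵐ`, at the new point `y = f x`, of the one-forms
transformed by `f`. -/
def transformed (σ : Coord → Matrix (Fin 3) (Fin 3) ℝ) (f : OpenPartialHomeomorph Coord Coord)
    (y : Coord) : Matrix (Fin 3) (Fin 3) ℝ :=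
  σ (f.symm y) * jacobian f.symm y

/-- `f` mixes the one-forms by the constant matrix `L`: `σ̃^α_m(y) = ∑_μ L^α_μ σ^μ_m(y)` at every
new point `y`. -/
def MixesBy (σ : Coord → Matrix (Fin 3) (Fin 3) ℝ) (f : OpenPartialHomeomorph Coord Coord)
    (L : Matrix (Fin 3) (Fin 3) ℝ) : Prop :=
  ∀ y ∈ f.target, transformed σ f y = L * σ y

/-- The right-hand side `∑_{α,β} σ^i_α(y) S^α_β σ^β_j(x)` (row `i`, column `j`) of the first-order
system, where `σ^i_α` is the inverse matrix of `σ^α_i`. -/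
def rhs (σ : Coord → Matrix (Fin 3) (Fin 3) ℝ) (S : Matrix (Fin 3) (Fin 3) ℝ) (x y : Coord) :
    Matrix (Fin 3) (Fin 3) ℝ :=
  (σ y)⁻¹ * S * σ x

/-- `f` solves `∂fⁱ/∂xʲ = ∑_{α,β} σ^i_α(f) S^α_β σ^β_j(x)` on `V`. -/
def SolvesSystem (σ : Coord → Matrix (Fin 3) (Fin 3) ℝ) (S : Matrix (Fin 3) (Fin 3) ℝ)
    (V : Set Coord) (f : Coord → Coord) : Prop :=
  ∀ x ∈ V, ∀ i j, pd j (fun z => f z i) x = rhs σ S x (f x) i j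

/-- The second derivative `∂_k ∂_l fⁱ` that the system prescribes, at `x`, for a solution with
value `y` at `x`: differentiate the `l`-th equation by the chain rule in `x` and in `y = f x`, and
replace `∂_k fᵐ` by the system. -/
def prescribedSecond (σ : Coord → Matrix (Fin 3) (Fin 3) ℝ) (S : Matrix (Fin 3) (Fin 3) ℝ)
    (i k l : Fin 3) (x y : Coord) : ℝ :=
  pd k (fun z => rhs σ S z y i l) x
    + ∑ m, pd m (fun w => rhs σ S x w i l) y * rhs σ S x y m k

/-- The integrability condition `∂_k ∂_l fⁱ - ∂_l ∂_k fⁱ = 0` of the system on `U`. -/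
def Integrability (U : Set Coord) (σ : Coord → Matrix (Fin 3) (Fin 3) ℝ)
    (S : Matrix (Fin 3) (Fin 3) ℝ) : Prop :=
  ∀ x ∈ U, ∀ y ∈ U, ∀ i k l,
    prescribedSecond σ S i k l x y - prescribedSecond σ S i l k x y = 0

end Bianchi

end

/-! Mixing by `Λ` means σ(x) = Λ σ(f x) Df(x), that is Df(x) = σ(f x)⁻¹ S σ(x): a total differential
equation Df = R(x, f x) (`IsCoordChange.mixesBy_iff`). In the difference of its prescribed mixed
derivatives the structure equation replaces all derivatives of σ, at x and at y, by products of
frames with C. The frames then factor out as invertible matrices and leave a constant tensor, C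
contracted with S minus C evaluated on two copies of S (`IsInvariantBasis.prescribedSecond_sub`). It
vanishes exactly when S preserves the bracket, and this no longer mentions x or y.

Hence a single differentiable solution, whose second derivatives commute at one point, forces S to
be an automorphism. Conversely, an automorphism makes the system integrable on all of `U × U`.
Frobenius' theorem then gives a local solution with any initial value, and the inverse function
theorem turns it into a coordinate change, since R takes invertible values
(`IsInvariantBasis.exists_coordChange`).

Frobenius' theorem is proved by integrating along rays: f(x) is the value at time 1 of the ODE
solution along the segment from `x₀` to x. Integrability and Grönwall's inequality show that
neighbouring rays differ to first order by R, so the radial construction solves the equation in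
every direction. -/

noncomputable section

open Set Metric Filter Topology NNReal

/-! ### Frobenius' theorem for total differential equations df = R(x, f). -/

namespace TotalDifferential

variable {E F : Type*} [NormedAddCommGroup E] [NormedSpace ℝ E]
  [NormedAddCommGroup F] [NormedSpace ℝ F]

/-- Uniform bounds on a ball for the coefficients `R` of a total differential equation
`df = R (x, f x)`, together with its integrability condition. -/
structure LocalBounds (R : E × F → E →L[ℝ] F) (D : E × F → E × F →L[ℝ] E →L[ℝ] F)
    (x₀ : E) (y₀ : F) (a : ℝ) (K : ℝ≥0) : Prop where
  a_pos : 0 < a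
  one_le : 1 ≤ (K : ℝ)
  hasFDerivAt : ∀ p ∈ ball (x₀, y₀) (3 * a), HasFDerivAt R (D p) p
  norm_le : ∀ p ∈ ball (x₀, y₀) (3 * a), ‖R p‖ ≤ K
  norm_deriv_le : ∀ p ∈ ball (x₀, y₀) (3 * a), ‖D p‖ ≤ K
  norm_deriv_sub_le : ∀ p ∈ ball (x₀, y₀) (3 * a), ∀ q ∈ ball (x₀, y₀) (3 * a),
    ‖D q - D p‖ ≤ K * ‖q - p‖
  integrable : ∀ p ∈ ball (x₀, y₀) (3 * a), ∀ v h, D p (v, R p v) h = D p (h, R p h) v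

variable {R : E × F → E →L[ℝ] F} {D : E × F → E × F →L[ℝ] E →L[ℝ] F}
  {x₀ : E} {y₀ : F} {a : ℝ} {K : ℝ≥0}

namespace LocalBounds

theorem norm_sub_le (H : LocalBounds R D x₀ y₀ a K) {p q : E × F}
    (hp : p ∈ ball (x₀, y₀) (3 * a)) (hq : q ∈ ball (x₀, y₀) (3 * a)) :
    ‖R q - R p‖ ≤ K * ‖q - p‖ :=
  (convex_ball _ _).norm_image_sub_le_of_norm_hasFDerivWithin_le
    (fun z hz => (H.hasFDerivAt z hz).hasFDerivWithinAt) H.norm_deriv_le hp hq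

theorem norm_taylor_le (H : LocalBounds R D x₀ y₀ a K) {p q : E × F}
    (hp : p ∈ ball (x₀, y₀) (3 * a)) (hq : q ∈ ball (x₀, y₀) (3 * a)) :
    ‖R q - R p - D p (q - p)‖ ≤ K * ‖q - p‖ * ‖q - p‖ := by
  -- On the intersection with this closed ball, still convex, `D` differs from `D p` by at most `K *
  -- ‖q - p‖`.
  refine ((convex_ball (x₀, y₀) (3 * a)).inter
    (convex_closedBall p ‖q - p‖)).norm_image_sub_le_of_norm_hasFDerivWithin_le'
    (fun z hz => (H.hasFDerivAt z hz.1).hasFDerivWithinAt) (fun z hz => ?_)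
    ⟨hp, mem_closedBall_self (norm_nonneg _)⟩ ⟨hq, by simp [dist_eq_norm]⟩
  refine (H.norm_deriv_sub_le p hp z hz.1).trans ?_
  gcongr
  simpa [dist_eq_norm] using hz.2

/-- The radius `3 * a` leaves room for the radial solutions, within `a` of `y₀`, and for their
first-order corrections, within `2 * a`. -/
theorem mem_ball (H : LocalBounds R D x₀ y₀ a K) {x : E} {y : F}
    (hx : ‖x‖ ≤ a) (hy : dist y y₀ ≤ 2 * a) {t : ℝ} (ht : t ∈ Icc (0 : ℝ) 1) :
    (x₀ + t • x, y) ∈ ball (x₀, y₀) (3 * a) := by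
  have ha := H.a_pos
  rw [Metric.mem_ball, Prod.dist_eq, max_lt_iff]
  refine ⟨?_, by simp only; linarith⟩
  simp only [dist_eq_norm, add_sub_cancel_left, norm_smul, Real.norm_eq_abs, abs_of_nonneg ht.1]
  nlinarith [norm_nonneg x, ht.2]

/-- A solution along the segment from `x₀` to `x₀ + v`. -/
theorem exists_radial [CompleteSpace F] (H : LocalBounds R D x₀ y₀ a K) {v : E}
    (hv1 : ‖v‖ ≤ 1) (hva : K * ‖v‖ ≤ a) :
    ∃ c : ℝ → F, c 0 = y₀ ∧ ∀ t ∈ Icc (0 : ℝ) 1, dist (c t) y₀ ≤ a ∧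
      HasDerivWithinAt c (R (x₀ + t • v, c t) v) (Icc 0 1) t := by
  have ha := H.a_pos
  have hva' : ‖v‖ ≤ a := by nlinarith [H.one_le, norm_nonneg v]
  have hmem : ∀ t ∈ Icc (0 : ℝ) 1, ∀ y ∈ closedBall y₀ a,
      (x₀ + t • v, y) ∈ ball (x₀, y₀) (3 * a) := fun t ht y hy =>
    H.mem_ball hva' (by rw [mem_closedBall] at hy; linarith) ht
  let A : ℝ≥0 := ⟨a, ha.le⟩
  -- The speed is at most `K * ‖v‖ ≤ a`, so a curve from `y₀` cannot leave the ball of radius `a`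
  -- before time 1; hence `A` is both the radius and the speed bound.
  have hPL : IsPicardLindelof (fun t y => R (x₀ + t • v, y) v)
      (⟨0, by simp⟩ : Icc (0 : ℝ) 1) y₀ A 0 A K := by
    refine ⟨fun t ht => ?_, fun y hy => ?_, fun t ht y hy => ?_, by simp⟩
    · refine LipschitzOnWith.of_dist_le_mul fun y hy z hz => ?_
      rw [dist_eq_norm, dist_eq_norm, ← sub_apply]
      have h1 := H.norm_sub_le (hmem t ht z hz) (hmem t ht y hy)
      simp only [Prod.mk_sub_mk, sub_self, Prod.norm_mk, norm_zero, norm_nonneg,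
        sup_of_le_right] at h1
      calc _ ≤ ‖R (x₀ + t • v, y) - R (x₀ + t • v, z)‖ * ‖v‖ :=
            ContinuousLinearMap.le_opNorm _ _
        _ ≤ (K * ‖y - z‖) * 1 := by gcongr
        _ = _ := mul_one _
    · intro t ht
      have h1 : ContinuousAt R (x₀ + t • v, y) := (H.hasFDerivAt _ (hmem t ht y hy)).continuousAt
      have h2 : ContinuousAt (fun s : ℝ => (x₀ + s • v, y)) t := by fun_prop
      have h3 : ContinuousAt (fun s : ℝ => R (x₀ + s • v, y)) t :=
        ContinuousAt.comp (f := fun s : ℝ => (x₀ + s • v, y)) h1 h2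
      exact (h3.clm_apply continuousAt_const).continuousWithinAt
    · calc _ ≤ ‖R (x₀ + t • v, y)‖ * ‖v‖ := ContinuousLinearMap.le_opNorm _ _
        _ ≤ K * ‖v‖ := by gcongr; exact H.norm_le _ (hmem t ht y hy)
        _ ≤ A := hva
  -- The fixed point of the Picard operator itself is kept because it carries the bound `dist (c t)
  -- y₀ ≤ a`.
  obtain ⟨α, hα⟩ := ODE.FunSpace.exists_isFixedPt_next hPL (mem_closedBall_self le_rfl)
  have hin : ∀ t : ℝ, α.compProj t ∈ closedBall y₀ a :=
    fun t => α.compProj_mem_closedBall hPL.mul_max_le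
  refine ⟨α.compProj, ?_, fun t ht => ⟨hin t, ?_⟩⟩
  · have := ODE.FunSpace.compProj_val (α := α) (t := (⟨0, by simp⟩ : Icc (0 : ℝ) 1))
    rw [← hα, ODE.FunSpace.next_apply₀] at this
    rwa [← hα]
  · refine ODE.hasDerivWithinAt_picard_Icc (t₀ := 0) (by simp) hPL.continuousOn_uncurry
      α.continuous_compProj.continuousOn (fun _ _ => hin _) y₀ ht |>.congr_of_mem ?_ ht
    intro s hs
    nth_rw 1 [← hα]
    rw [ODE.FunSpace.compProj_of_mem hs, ODE.FunSpace.next_apply]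

/-- Along two neighbouring segments the solutions differ by `R h` up to `O(‖h‖²)`. -/
theorem norm_radial_sub_le (H : LocalBounds R D x₀ y₀ a K) {v h : E} {c c' : ℝ → F}
    (hv1 : ‖v‖ ≤ 1) (hva : ‖v‖ ≤ a) (hw1 : ‖v + h‖ ≤ 1) (hwa : ‖v + h‖ ≤ a)
    (hha : K * ‖h‖ ≤ a) (hc0 : c 0 = y₀) (hc0' : c' 0 = y₀)
    (hc : ∀ t ∈ Icc (0 : ℝ) 1, dist (c t) y₀ ≤ a ∧
      HasDerivWithinAt c (R (x₀ + t • v, c t) v) (Icc 0 1) t)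
    (hc' : ∀ t ∈ Icc (0 : ℝ) 1, dist (c' t) y₀ ≤ a ∧
      HasDerivWithinAt c' (R (x₀ + t • (v + h), c' t) (v + h)) (Icc 0 1) t) :
    ‖c' 1 - c 1 - R (x₀ + v, c 1) h‖ ≤
      ((K : ℝ) ^ 3 + K ^ 2) / K * (Real.exp K - 1) * ‖h‖ ^ 2 := by
  have ha := H.a_pos
  have hK := H.one_le
  let p : ℝ → E × F := fun t => (x₀ + t • v, c t)
  have hp : ∀ t ∈ Icc (0 : ℝ) 1, p t ∈ ball (x₀, y₀) (3 * a) := fun t ht =>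
    H.mem_ball hva (by linarith [(hc t ht).1]) ht
  -- The expected solution along `v + h` to first order in `h`; at time 1 it is `c 1 + R (x₀ + v, c
  -- 1) h`.
  let g : ℝ → F := fun t => c t + t • R (p t) h
  have hRh : ∀ t ∈ Icc (0 : ℝ) 1, ‖t • R (p t) h‖ ≤ K * ‖h‖ := fun t ht => by
    rw [norm_smul, Real.norm_eq_abs, abs_of_nonneg ht.1]
    calc t * ‖R (p t) h‖ ≤ 1 * (K * ‖h‖) := by
          gcongr
          · exact ht.2
          · exact (ContinuousLinearMap.le_opNorm _ _).trans (by gcongr; exact H.norm_le _ (hp t ht))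
      _ = _ := one_mul _
  have hgball : ∀ t ∈ Icc (0 : ℝ) 1, dist (g t) y₀ ≤ 2 * a := fun t ht => by
    have h1 : dist (g t) (c t) ≤ a := by
      simp only [g, dist_eq_norm, add_sub_cancel_left]
      exact (hRh t ht).trans hha
    linarith [dist_triangle (g t) (c t) y₀, (hc t ht).1]
  have hq : ∀ t ∈ Icc (0 : ℝ) 1, (x₀ + t • (v + h), g t) ∈ ball (x₀, y₀) (3 * a) := fun t ht =>
    H.mem_ball hwa (hgball t ht) ht
  have hgd : ∀ t ∈ Icc (0 : ℝ) 1, HasDerivWithinAt g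
      (R (p t) (v + h) + t • D (p t) (h, R (p t) h) v) (Icc 0 1) t := fun t ht => by
    have hpd : HasDerivWithinAt p (v, R (p t) v) (Icc 0 1) t := by
      refine HasDerivWithinAt.prodMk ?_ (hc t ht).2
      simpa using ((hasDerivWithinAt_id t (Icc (0 : ℝ) 1)).smul_const v).const_add x₀
    have h1 := (H.hasFDerivAt _ (hp t ht)).comp_hasDerivWithinAt t hpd
    have h2 := h1.clm_apply (hasDerivWithinAt_const t (Icc (0 : ℝ) 1) h)
    have h3 := (hc t ht).2.add ((hasDerivWithinAt_id t (Icc (0 : ℝ) 1)).smul h2)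
    refine h3.congr_deriv ?_
    -- The one use of integrability: it turns the derivative of `g` into the first-order expansion
    -- at `p t` of the vector field along `v + h`.
    rw [← H.integrable _ (hp t ht)]
    simp only [p, Function.comp, id, map_zero, add_zero, one_smul, map_add]
    abel
  have hbound : ∀ t ∈ Icc (0 : ℝ) 1,
      dist (R (p t) (v + h) + t • D (p t) (h, R (p t) h) v) (R (x₀ + t • (v + h), g t) (v + h))
        ≤ ((K : ℝ) ^ 3 + K ^ 2) * ‖h‖ ^ 2 := fun t ht => by
    set q : E × F := (x₀ + t • (v + h), g t) with hqdef
    have hqp : q - p t = t • (h, R (p t) h) := by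
      simp only [q, p, g, Prod.mk_sub_mk, Prod.smul_mk, smul_add]
      congr 1 <;> abel
    have hn : ‖q - p t‖ ≤ K * ‖h‖ := by
      rw [hqp, Prod.smul_mk, Prod.norm_mk, max_le_iff]
      refine ⟨?_, hRh t ht⟩
      rw [norm_smul, Real.norm_eq_abs, abs_of_nonneg ht.1]
      exact mul_le_mul_of_nonneg_right (ht.2.trans hK) (norm_nonneg _)
    -- The defect is a Taylor remainder applied to `v`, giving `K ^ 3`, and a Lipschitz difference
    -- applied to `h`, giving `K ^ 2`.
    have e1 : R (p t) (v + h) + t • D (p t) (h, R (p t) h) v - R q (v + h)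
        = -((R q - R (p t) - D (p t) (q - p t)) v) - (R q - R (p t)) h := by
      rw [hqp]
      simp only [map_smul, map_add, sub_apply, smul_apply]
      abel
    rw [dist_eq_norm, e1]
    calc _ ≤ ‖(R q - R (p t) - D (p t) (q - p t)) v‖ + ‖(R q - R (p t)) h‖ := by
          refine (_root_.norm_sub_le _ _).trans (by rw [norm_neg])
      _ ≤ K * ‖q - p t‖ * ‖q - p t‖ * ‖v‖ + K * ‖q - p t‖ * ‖h‖ := by
          gcongr
          · exact (ContinuousLinearMap.le_opNorm _ _).trans
              (by gcongr; exact H.norm_taylor_le (hp t ht) (hq t ht))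
          · exact (ContinuousLinearMap.le_opNorm _ _).trans
              (by gcongr; exact H.norm_sub_le (hp t ht) (hq t ht))
      _ ≤ K * (K * ‖h‖) * (K * ‖h‖) * 1 + K * (K * ‖h‖) * ‖h‖ := by gcongr
      _ = _ := by ring
  have hLip : ∀ t ∈ Ico (0 : ℝ) 1, LipschitzOnWith K (fun y => R (x₀ + t • (v + h), y) (v + h))
      (closedBall y₀ (2 * a)) := fun t ht => by
    refine LipschitzOnWith.of_dist_le_mul fun y hy z hz => ?_
    rw [dist_eq_norm, dist_eq_norm, ← sub_apply]
    have h1 := H.norm_sub_le (H.mem_ball hwa hz (Ico_subset_Icc_self ht))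
      (H.mem_ball hwa hy (Ico_subset_Icc_self ht))
    simp only [Prod.mk_sub_mk, sub_self, Prod.norm_mk, norm_zero, norm_nonneg,
      sup_of_le_right] at h1
    calc _ ≤ ‖R (x₀ + t • (v + h), y) - R (x₀ + t • (v + h), z)‖ * ‖v + h‖ :=
          ContinuousLinearMap.le_opNorm _ _
      _ ≤ (K * ‖y - z‖) * 1 := by gcongr
      _ = _ := mul_one _
  have hIci : ∀ {k : ℝ → F} {k' : F} {t : ℝ}, t ∈ Ico (0 : ℝ) 1 →
      HasDerivWithinAt k k' (Icc 0 1) t → HasDerivWithinAt k k' (Ici t) t := fun ht hk =>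
    hk.mono_of_mem_nhdsWithin (Icc_mem_nhdsGE_of_mem ht)
  -- Grönwall: `c'` is an exact solution, `g` has defect `O(‖h‖ ^ 2)`, and both start at `y₀`.
  have key := dist_le_of_approx_trajectories_ODE_of_mem (a := 0) (b := 1) (δ := 0) (εf := 0)
    (v := fun t y => R (x₀ + t • (v + h), y) (v + h)) (s := fun _ => closedBall y₀ (2 * a))
    hLip (fun t ht => (hc' t ht).2.continuousWithinAt)
    (fun t ht => hIci ht (hc' t (Ico_subset_Icc_self ht)).2) (fun t ht => by simp)
    (fun t ht => by
      rw [mem_closedBall]; linarith [(hc' t (Ico_subset_Icc_self ht)).1])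
    (fun t ht => (hgd t ht).continuousWithinAt)
    (fun t ht => hIci ht (hgd t (Ico_subset_Icc_self ht)))
    (fun t ht => hbound t (Ico_subset_Icc_self ht))
    (fun t ht => hgball t (Ico_subset_Icc_self ht))
    (by simp [g, hc0, hc0']) 1 (by simp)
  rw [gronwallBound_of_K_ne_0 (by linarith)] at key
  simp only [g, p, dist_eq_norm, one_smul, zero_mul, zero_add, sub_zero, mul_one] at key
  rw [sub_sub]
  refine key.trans (le_of_eq ?_)
  ring

/-- Local solvability of an integrable total differential equation. -/
theorem exists_solution [CompleteSpace F] (H : LocalBounds R D x₀ y₀ a K) :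
    ∃ f : E → F, f x₀ = y₀ ∧ ∀ᶠ x in 𝓝 x₀, HasFDerivAt f (R (x, f x)) x := by
  have ha := H.a_pos
  have hK := H.one_le
  set r : ℝ := min 1 (a / K) with hr
  have hr0 : 0 < r := lt_min one_pos (by positivity)
  have hr1 : ∀ {v : E}, ‖v‖ < r → ‖v‖ ≤ 1 := fun hv => hv.le.trans (min_le_left _ _)
  have hrK : ∀ {v : E}, ‖v‖ < r → K * ‖v‖ ≤ a := fun {v} hv => by
    have := hv.le.trans (min_le_right _ _)
    rw [le_div_iff₀ (by linarith)] at this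
    linarith
  have hra : ∀ {v : E}, ‖v‖ < r → ‖v‖ ≤ a := fun {v} hv => by
    nlinarith [hrK hv, norm_nonneg v]
  have hex : ∀ v : E, ∃ c : ℝ → F, ‖v‖ < r → c 0 = y₀ ∧ ∀ t ∈ Icc (0 : ℝ) 1, dist (c t) y₀ ≤ a ∧
      HasDerivWithinAt c (R (x₀ + t • v, c t) v) (Icc 0 1) t := fun v => by
    by_cases hv : ‖v‖ < r
    · obtain ⟨c, hc⟩ := H.exists_radial (hr1 hv) (hrK hv)
      exact ⟨c, fun _ => hc⟩
    -- A dummy curve for long `v`, so that `choose` gives a total function.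
    · exact ⟨0, fun h => absurd h hv⟩
  choose c hc using hex
  refine ⟨fun x => c (x - x₀) 1, ?_, ?_⟩
  -- The ray to `x₀` itself has `v = 0`, so its curve is constant.
  · have h0 := hc 0 (by simpa using hr0)
    have := constant_of_derivWithin_zero (f := c 0) (a := 0) (b := 1)
      (fun t ht => (h0.2 t ht).2.differentiableWithinAt)
      (fun t ht => by
        have := (h0.2 t (Ico_subset_Icc_self ht)).2
        rw [this.derivWithin (uniqueDiffOn_Icc one_pos t (Ico_subset_Icc_self ht))]
        simp) 1 (by simp)
    simp only [sub_self]
    rw [this, h0.1]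
  · filter_upwards [ball_mem_nhds x₀ hr0] with x hx
    have hv : ‖x - x₀‖ < r := by simpa [dist_eq_norm] using hx
    rw [hasFDerivAt_iff_isLittleO_nhds_zero]
    have hev : ∀ᶠ h : E in 𝓝 0, ‖h‖ < r ∧ ‖x - x₀ + h‖ < r := by
      refine (ContinuousAt.eventually_lt (by fun_prop) continuousAt_const (by simpa using hr0)).and
        (ContinuousAt.eventually_lt (by fun_prop) continuousAt_const (by simpa using hv))
    have hO : (fun h : E => c (x + h - x₀) 1 - c (x - x₀) 1 - R (x, c (x - x₀) 1) h)
        =O[𝓝 0] fun h : E => ‖h‖ ^ 2 := by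
      refine Asymptotics.IsBigO.of_bound (((K : ℝ) ^ 3 + K ^ 2) / K * (Real.exp K - 1)) ?_
      filter_upwards [hev] with h hh
      have h1 := H.norm_radial_sub_le (hr1 hv) (hra hv) (hr1 hh.2) (hra hh.2) (hrK hh.1)
        (hc _ hv).1 (hc _ hh.2).1 (hc _ hv).2 (hc _ hh.2).2
      rw [add_sub_cancel] at h1
      rw [show x + h - x₀ = x - x₀ + h by abel]
      simpa using h1
    exact hO.trans_isLittleO (Asymptotics.isLittleO_norm_pow_id one_lt_two)

end LocalBounds

/-- Frobenius' theorem for total differential equations. -/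
theorem exists_solution [CompleteSpace F] (hR : ContDiffAt ℝ 2 R (x₀, y₀))
    (hint : ∀ᶠ p in 𝓝 (x₀, y₀), ∀ v h,
      fderiv ℝ R p (v, R p v) h = fderiv ℝ R p (h, R p h) v) :
    ∃ f : E → F, f x₀ = y₀ ∧ ∀ᶠ x in 𝓝 x₀, HasFDerivAt f (R (x, f x)) x := by
  -- Class C² enters here: the derivative is C¹, hence locally Lipschitz.
  have hD : ContDiffAt ℝ 1 (fderiv ℝ R) (x₀, y₀) := hR.fderiv_right (by norm_num)
  obtain ⟨K', t, ht, hKt⟩ := hD.exists_lipschitzOnWith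
  have hdiff : ∀ᶠ p in 𝓝 (x₀, y₀), HasFDerivAt R (fderiv ℝ R p) p := by
    filter_upwards [hR.eventually (by simp)] with p hp
    exact (hp.differentiableAt (by simp)).hasFDerivAt
  have hb1 : ∀ᶠ p in 𝓝 (x₀, y₀), ‖R p‖ < ‖R (x₀, y₀)‖ + 1 :=
    hR.continuousAt.norm.eventually_lt continuousAt_const (lt_add_one _)
  have hDc : ContinuousAt (fun p => ‖fderiv ℝ R p‖) (x₀, y₀) :=
    (continuous_norm (E := E × F →L[ℝ] E →L[ℝ] F)).continuousAt.comp hD.continuousAt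
  have hb2 : ∀ᶠ p in 𝓝 (x₀, y₀), ‖fderiv ℝ R p‖ < ‖fderiv ℝ R (x₀, y₀)‖ + 1 :=
    hDc.eventually_lt continuousAt_const (lt_add_one _)
  obtain ⟨δ, hδ, hball⟩ := Metric.eventually_nhds_iff_ball.1
    (hdiff.and (hb1.and (hb2.and (hint.and ht))))
  -- A sum dominating all the required bounds at once, and at least 1.
  let K : ℝ≥0 := K' + 1 + (‖R (x₀, y₀)‖₊ + 1) + (‖fderiv ℝ R (x₀, y₀)‖₊ + 1)
  have hK : (K : ℝ) = K' + 1 + (‖R (x₀, y₀)‖ + 1) + (‖fderiv ℝ R (x₀, y₀)‖ + 1) := by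
    simp [K]
  have n1 := K'.2
  have n2 := norm_nonneg (R (x₀, y₀))
  have n3 := norm_nonneg (fderiv ℝ R (x₀, y₀))
  have n4 : (K' : ℝ) ≤ K := by rw [hK]; linarith
  have e : 3 * (δ / 3) = δ := by ring
  have H : LocalBounds R (fderiv ℝ R) x₀ y₀ (δ / 3) K := by
    refine ⟨by positivity, ?_, ?_, ?_, ?_, ?_, ?_⟩ <;> try rw [e]
    · rw [hK]; simp only [NNReal.val_eq_coe] at n1; linarith
    · exact fun p hp => (hball p hp).1
    · intro p hp
      have := (hball p hp).2.1
      rw [hK]; simp only [NNReal.val_eq_coe] at n1; linarith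
    · intro p hp
      have := (hball p hp).2.2.1
      rw [hK]; simp only [NNReal.val_eq_coe] at n1; linarith
    · intro p hp q hq
      have h1 := hKt.dist_le_mul q (hball q hq).2.2.2.2 p (hball p hp).2.2.2.2
      rw [dist_eq_norm, dist_eq_norm] at h1
      exact h1.trans (by gcongr)
    · exact fun p hp => (hball p hp).2.2.2.1
  exact H.exists_solution

/-- A solution of a total differential equation with smooth coefficients is smooth. -/
theorem contDiffOn_solution {W : Set (E × F)} (hR : ContDiffOn ℝ ∞ R W) {f : E → F} {V : Set E}
    (hV : IsOpen V) (hf : ∀ x ∈ V, HasFDerivAt f (R (x, f x)) x) (hW : ∀ x ∈ V, (x, f x) ∈ W) :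
    ContDiffOn ℝ ∞ f V := by
  refine contDiffOn_infty.2 fun n => ?_
  -- Bootstrapping: if `f` is Cⁿ, so is its derivative `R (x, f x)`, and `f` is Cⁿ⁺¹.
  induction n with
  | zero => exact contDiffOn_zero.2 fun x hx => (hf x hx).continuousAt.continuousWithinAt
  | succ n ih =>
    push_cast
    rw [contDiffOn_succ_iff_fderiv_of_isOpen hV]
    refine ⟨fun x hx => (hf x hx).differentiableAt.differentiableWithinAt, by simp, ?_⟩
    have h1 : ContDiffOn ℝ n (fun x => R (x, f x)) V :=
      (hR.of_le (by exact_mod_cast le_top)).comp (contDiffOn_id.prodMk ih) hW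
    exact h1.congr fun x hx => (hf x hx).fderiv

/-- The integrability condition holds along the graph of a solution. -/
theorem integrable_of_solution {f : E → F} {x : E} (hR : DifferentiableAt ℝ R (x, f x))
    (hf : ∀ᶠ z in 𝓝 x, HasFDerivAt f (R (z, f z)) z) (v h : E) :
    fderiv ℝ R (x, f x) (v, R (x, f x) v) h = fderiv ℝ R (x, f x) (h, R (x, f x) h) v := by
  have h1 : HasFDerivAt (fun z => R (z, f z))
      ((fderiv ℝ R (x, f x)).comp ((ContinuousLinearMap.id ℝ E).prod (R (x, f x)))) x :=
    HasFDerivAt.comp (f := fun z => (z, f z)) x hR.hasFDerivAt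
      ((hasFDerivAt_id x).prodMk hf.self_of_nhds)
  -- No C² assumption on `f` is needed: its derivative `R (z, f z)` is differentiable at `x` by the
  -- chain rule.
  simpa using second_derivative_symmetric_of_eventually hf h1 v h

end TotalDifferential

end

noncomputable section

open Set Metric Filter Topology

/-! ### The system of the frames and its integrability tensor. -/

namespace Bianchi

/-- The right-hand side of the system as a continuous linear map. -/
def rhsCLM (σ : Coord → Matrix (Fin 3) (Fin 3) ℝ) (S : Matrix (Fin 3) (Fin 3) ℝ)
    (p : Coord × Coord) : Coord →L[ℝ] Coord :=
  ∑ i, ∑ j, rhs σ S p.1 p.2 i j •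
    (ContinuousLinearMap.proj (R := ℝ) (φ := fun _ : Fin 3 => ℝ) j).smulRight
      (Pi.single i 1 : Coord)

/-- The matrix of partial derivatives `∂_m σ^α_i`. -/
def pdForms (σ : Coord → Matrix (Fin 3) (Fin 3) ℝ) (m : Fin 3) (x : Coord) :
    Matrix (Fin 3) (Fin 3) ℝ :=
  Matrix.of fun α i => pd m (fun z => σ z α i) x

variable {σ : Coord → Matrix (Fin 3) (Fin 3) ℝ} {S Λ : Matrix (Fin 3) (Fin 3) ℝ} {U : Set Coord}
  {C : Fin 3 → Fin 3 → Fin 3 → ℝ}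

theorem rhsCLM_apply (p : Coord × Coord) (h : Coord) (i : Fin 3) :
    rhsCLM σ S p h i = ∑ j, rhs σ S p.1 p.2 i j * h j := by
  simp [rhsCLM, Finset.sum_apply, Pi.single_apply]

theorem rhsCLM_single (p : Coord × Coord) (i j : Fin 3) :
    rhsCLM σ S p (Pi.single j 1) i = rhs σ S p.1 p.2 i j := by
  simp [rhsCLM_apply, Pi.single_apply]

theorem pd_coord {f : Coord → Coord} {f' : Coord →L[ℝ] Coord} {x : Coord}
    (hf : HasFDerivAt f f' x) (i j : Fin 3) :
    pd j (fun z => f z i) x = f' (Pi.single j 1) i := by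
  rw [pd, (hasFDerivAt_pi'.1 hf i).fderiv]
  rfl

theorem ext_single {A B : Coord →L[ℝ] Coord}
    (h : ∀ i j, A (Pi.single j 1) i = B (Pi.single j 1) i) : A = B :=
  ContinuousLinearMap.coe_injective <| LinearMap.pi_ext' fun j => LinearMap.ext_ring <|
    funext fun i => h i j

theorem SolvesSystem.hasFDerivAt {V : Set Coord} {f : Coord → Coord} {x : Coord}
    (hf : SolvesSystem σ S V f) (hx : x ∈ V) (hd : DifferentiableAt ℝ f x) :
    HasFDerivAt f (rhsCLM σ S (x, f x)) x := by
  convert hd.hasFDerivAt using 1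
  refine ext_single fun i j => ?_
  rw [rhsCLM_single, ← pd_coord hd.hasFDerivAt, hf x hx]

theorem apply_eq_sum_single {M : Type*} [NormedAddCommGroup M] [NormedSpace ℝ M]
    (A : Coord →L[ℝ] M) (v : Coord) : A v = ∑ k, v k • A (Pi.single k 1) := by
  conv_lhs => rw [← Finset.univ_sum_single v]
  rw [map_sum]
  refine Finset.sum_congr rfl fun k _ => ?_
  rw [← map_smul, ← Pi.single_smul, smul_eq_mul, mul_one]

theorem contDiffOn_det {A : Coord → Matrix (Fin 3) (Fin 3) ℝ}
    (hA : ∀ i j, ContDiffOn ℝ ∞ (fun x => A x i j) U) : ContDiffOn ℝ ∞ (fun x => (A x).det) U := by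
  simp only [Matrix.det_apply]
  exact ContDiffOn.sum fun τ _ => (contDiffOn_prod fun i _ => hA _ _).const_smul _

theorem IsInvariantBasis.smooth_inv (hσ : IsInvariantBasis C U σ) (i α : Fin 3) :
    ContDiffOn ℝ ∞ (fun x => (σ x)⁻¹ i α) U := by
  simp only [Matrix.inv_def, Ring.inverse_eq_inv', Matrix.smul_apply, smul_eq_mul,
    Matrix.adjugate_apply]
  refine ((contDiffOn_det hσ.smooth).inv hσ.nonsingular).mul (contDiffOn_det fun j k => ?_)
  by_cases h : j = α
  · subst h
    simpa using contDiffOn_const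
  · simpa [Matrix.updateRow_ne h] using hσ.smooth j k

theorem IsInvariantBasis.smooth_rhs (hσ : IsInvariantBasis C U σ)
    (S : Matrix (Fin 3) (Fin 3) ℝ) (i j : Fin 3) :
    ContDiffOn ℝ ∞ (fun p : Coord × Coord => rhs σ S p.1 p.2 i j) (U ×ˢ U) := by
  simp only [rhs, Matrix.mul_apply]
  refine ContDiffOn.sum fun β _ => ContDiffOn.mul (ContDiffOn.sum fun α _ => ?_) ?_
  · exact ((hσ.smooth_inv i α).comp contDiff_snd.contDiffOn fun p hp => hp.2).mul contDiffOn_const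
  · exact (hσ.smooth β j).comp contDiff_fst.contDiffOn fun p hp => hp.1

theorem IsInvariantBasis.smooth_rhsCLM (hσ : IsInvariantBasis C U σ)
    (S : Matrix (Fin 3) (Fin 3) ℝ) : ContDiffOn ℝ ∞ (rhsCLM σ S) (U ×ˢ U) := by
  unfold rhsCLM
  exact ContDiffOn.sum fun i _ => ContDiffOn.sum fun j _ =>
    (hσ.smooth_rhs S i j).smul contDiffOn_const

theorem IsInvariantBasis.isUnit_det (hσ : IsInvariantBasis C U σ) {x : Coord} (hx : x ∈ U) :
    IsUnit (σ x).det :=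
  (hσ.nonsingular x hx).isUnit

/-- The second derivative prescribed by the system, in coordinate-free form. -/
theorem IsInvariantBasis.fderiv_rhsCLM_apply (hσ : IsInvariantBasis C U σ) (hU : IsOpen U)
    {x y : Coord} (hx : x ∈ U) (hy : y ∈ U) (v h : Coord) (i : Fin 3) :
    fderiv ℝ (rhsCLM σ S) (x, y) (v, rhsCLM σ S (x, y) v) h i
      = ∑ l, ∑ k, h l * v k * prescribedSecond σ S i k l x y := by
  have hnhds : U ×ˢ U ∈ 𝓝 (x, y) := prod_mem_nhds (hU.mem_nhds hx) (hU.mem_nhds hy)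
  have hd : ∀ i j, DifferentiableAt ℝ (fun p : Coord × Coord => rhs σ S p.1 p.2 i j) (x, y) :=
    fun i j => ((hσ.smooth_rhs S i j).contDiffAt hnhds).differentiableAt (by simp)
  have hD : DifferentiableAt ℝ (rhsCLM σ S) (x, y) :=
    ((hσ.smooth_rhsCLM S).contDiffAt hnhds).differentiableAt (by simp)
  have h1 : ∀ w, fderiv ℝ (rhsCLM σ S) (x, y) w h i
      = ∑ l, fderiv ℝ (fun p : Coord × Coord => rhs σ S p.1 p.2 i l) (x, y) w * h l := fun w => by
    have e1 : HasFDerivAt (fun p => rhsCLM σ S p h i)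
        ((ContinuousLinearMap.proj i).comp ((ContinuousLinearMap.apply ℝ Coord h).comp
          (fderiv ℝ (rhsCLM σ S) (x, y)))) (x, y) :=
      (ContinuousLinearMap.proj (R := ℝ) (φ := fun _ : Fin 3 => ℝ) i).hasFDerivAt.comp (x, y)
        ((ContinuousLinearMap.apply ℝ Coord h).hasFDerivAt.comp (x, y) hD.hasFDerivAt)
    have e2 : HasFDerivAt (fun p => rhsCLM σ S p h i)
        (∑ l, h l • fderiv ℝ (fun p : Coord × Coord => rhs σ S p.1 p.2 i l) (x, y)) (x, y) := by
      simp only [rhsCLM_apply]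
      exact HasFDerivAt.fun_sum fun l _ => (hd i l).hasFDerivAt.mul_const (h l)
    have := congrArg (fun A : Coord × Coord →L[ℝ] ℝ => A w) (e1.unique e2)
    simpa [sum_apply, mul_comm] using this
  have hfst : ∀ l k, pd k (fun z => rhs σ S z y i l) x
      = fderiv ℝ (fun p : Coord × Coord => rhs σ S p.1 p.2 i l) (x, y) (Pi.single k 1, 0) :=
    fun l k => by
      have := HasFDerivAt.comp (f := fun z : Coord => (z, y)) x (hd i l).hasFDerivAt
        ((hasFDerivAt_id x).prodMk (hasFDerivAt_const y x))
      rw [pd]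
      exact congrArg (fun A : Coord →L[ℝ] ℝ => A (Pi.single k 1)) this.fderiv
  have hsnd : ∀ l k, pd k (fun w => rhs σ S x w i l) y
      = fderiv ℝ (fun p : Coord × Coord => rhs σ S p.1 p.2 i l) (x, y) (0, Pi.single k 1) :=
    fun l k => by
      have := HasFDerivAt.comp (f := fun z : Coord => (x, z)) y (hd i l).hasFDerivAt
        ((hasFDerivAt_const x y).prodMk (hasFDerivAt_id y))
      rw [pd]
      exact congrArg (fun A : Coord →L[ℝ] ℝ => A (Pi.single k 1)) this.fderiv
  rw [h1]
  refine Finset.sum_congr rfl fun l _ => ?_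
  set A := fderiv ℝ (fun p : Coord × Coord => rhs σ S p.1 p.2 i l) (x, y) with hA
  have e1 := apply_eq_sum_single (A.comp (ContinuousLinearMap.inl ℝ Coord Coord)) v
  have e2 := apply_eq_sum_single (A.comp (ContinuousLinearMap.inr ℝ Coord Coord))
    (rhsCLM σ S (x, y) v)
  simp only [ContinuousLinearMap.comp_apply, ContinuousLinearMap.inl_apply,
    ContinuousLinearMap.inr_apply, smul_eq_mul] at e1 e2
  have e3 : A (v, rhsCLM σ S (x, y) v) = A (v, 0) + A (0, rhsCLM σ S (x, y) v) := by
    rw [← map_add]; simp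
  rw [e3, e1, e2]
  simp only [prescribedSecond, hfst, hsnd, ← hA, rhsCLM_apply, Finset.sum_mul, Finset.mul_sum,
    mul_add, add_mul, Finset.sum_add_distrib]
  congr 1
  · exact Finset.sum_congr rfl fun k _ => by ring
  · rw [Finset.sum_comm]
    exact Finset.sum_congr rfl fun k _ => Finset.sum_congr rfl fun m _ => by ring

/-- Both sides of the Frobenius condition are bilinear in `v` and `h`; its values on coordinate
vectors are the classical index condition. -/
theorem IsInvariantBasis.integrability_iff (hσ : IsInvariantBasis C U σ) (hU : IsOpen U)
    {x y : Coord} (hx : x ∈ U) (hy : y ∈ U) :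
    (∀ i k l, prescribedSecond σ S i k l x y - prescribedSecond σ S i l k x y = 0) ↔
      ∀ v h, fderiv ℝ (rhsCLM σ S) (x, y) (v, rhsCLM σ S (x, y) v) h
        = fderiv ℝ (rhsCLM σ S) (x, y) (h, rhsCLM σ S (x, y) h) v := by
  refine ⟨fun H v h => funext fun i => ?_, fun H i k l => ?_⟩
  · rw [hσ.fderiv_rhsCLM_apply hU hx hy, hσ.fderiv_rhsCLM_apply hU hx hy, Finset.sum_comm]
    refine Finset.sum_congr rfl fun k _ => Finset.sum_congr rfl fun l _ => ?_
    rw [sub_eq_zero.1 (H i k l)]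
    ring
  · have := congrFun (H (Pi.single k 1) (Pi.single l 1)) i
    rw [hσ.fderiv_rhsCLM_apply hU hx hy, hσ.fderiv_rhsCLM_apply hU hx hy] at this
    simpa [Pi.single_apply, sub_eq_zero] using this

theorem IsInvariantBasis.differentiableAt (hσ : IsInvariantBasis C U σ) (hU : IsOpen U)
    {x : Coord} (hx : x ∈ U) (α i : Fin 3) : DifferentiableAt ℝ (fun z => σ z α i) x :=
  ((hσ.smooth α i).contDiffAt (hU.mem_nhds hx)).differentiableAt (by simp)

theorem IsInvariantBasis.differentiableAt_inv (hσ : IsInvariantBasis C U σ) (hU : IsOpen U)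
    {x : Coord} (hx : x ∈ U) (i α : Fin 3) : DifferentiableAt ℝ (fun z => (σ z)⁻¹ i α) x :=
  ((hσ.smooth_inv i α).contDiffAt (hU.mem_nhds hx)).differentiableAt (by simp)

/-- Product rule for σ⁻¹ σ = 1, an identity valid on a neighbourhood of `y`. -/
theorem IsInvariantBasis.pd_inv (hσ : IsInvariantBasis C U σ) (hU : IsOpen U)
    {y : Coord} (hy : y ∈ U) (m : Fin 3) :
    Matrix.of (fun i α => pd m (fun w => (σ w)⁻¹ i α) y) =
      -((σ y)⁻¹ * pdForms σ m y * (σ y)⁻¹) := by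
  set dT : Matrix (Fin 3) (Fin 3) ℝ := Matrix.of (fun i α => pd m (fun w => (σ w)⁻¹ i α) y)
  have key : (σ y)⁻¹ * pdForms σ m y + dT * σ y = 0 := by
    ext i p
    have h1 : HasFDerivAt (fun w => ∑ α, (σ w)⁻¹ i α * σ w α p) _ y :=
      HasFDerivAt.fun_sum fun α _ => (hσ.differentiableAt_inv hU hy i α).hasFDerivAt.mul
        (hσ.differentiableAt hU hy α p).hasFDerivAt
    have h2 : HasFDerivAt (fun w => ∑ α, (σ w)⁻¹ i α * σ w α p) (0 : Coord →L[ℝ] ℝ) y := by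
      refine (hasFDerivAt_const ((1 : Matrix (Fin 3) (Fin 3) ℝ) i p) y).congr_of_eventuallyEq ?_
      filter_upwards [hU.mem_nhds hy] with w hw
      rw [← Matrix.mul_apply, Matrix.nonsing_inv_mul _ (hσ.isUnit_det hw)]
    have := congrArg (fun A : Coord →L[ℝ] ℝ => A (Pi.single m 1)) (h1.unique h2)
    simp only [sum_apply, add_apply, smul_apply, smul_eq_mul, zero_apply,
      Finset.sum_add_distrib] at this
    simp only [Matrix.add_apply, Matrix.mul_apply, Matrix.zero_apply, ← this, pdForms, dT,
      Matrix.of_apply, pd]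
    congr 1
    exact Finset.sum_congr rfl fun α _ => mul_comm _ _
  have h3 : dT * σ y * (σ y)⁻¹ = dT := Matrix.mul_nonsing_inv_cancel_right _ _ (hσ.isUnit_det hy)
  rw [← h3, eq_neg_of_add_eq_zero_right key, Matrix.neg_mul]

/-- Differentiating the inverse frame leaves a factor σ(y)⁻¹ S σ(x), which is `rhs` again. So σ(y)⁻¹
comes out in front and only derivatives of σ remain, ready for antisymmetrization. -/
theorem IsInvariantBasis.prescribedSecond_eq (hσ : IsInvariantBasis C U σ) (hU : IsOpen U)
    {x y : Coord} (hx : x ∈ U) (hy : y ∈ U) (i k l : Fin 3) :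
    prescribedSecond σ S i k l x y = ∑ α, (σ y)⁻¹ i α *
      (∑ ρ, S α ρ * pdForms σ k x ρ l
        - ∑ m, ∑ p, pdForms σ m y α p * rhs σ S x y p l * rhs σ S x y m k) := by
  have h1 : pd k (fun z => rhs σ S z y i l) x = ((σ y)⁻¹ * (S * pdForms σ k x)) i l := by
    rw [← Matrix.mul_assoc]
    simp only [rhs, pd]
    simp only [Matrix.mul_apply (M := (σ y)⁻¹ * S)]
    rw [(HasFDerivAt.fun_sum fun ρ _ =>
      (hσ.differentiableAt hU hx ρ l).hasFDerivAt.const_mul (((σ y)⁻¹ * S) i ρ)).fderiv]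
    simp [pdForms, pd]
  have h2 : ∀ m, pd m (fun w => rhs σ S x w i l) y
      = -((σ y)⁻¹ * (pdForms σ m y * rhs σ S x y)) i l := fun m => by
    have e : ((σ y)⁻¹ * (pdForms σ m y * rhs σ S x y))
        = (σ y)⁻¹ * pdForms σ m y * (σ y)⁻¹ * (S * σ x) := by
      simp only [rhs, Matrix.mul_assoc]
    rw [e, ← Matrix.neg_apply, ← Matrix.neg_mul, ← hσ.pd_inv hU hy m]
    simp only [rhs, pd, Matrix.mul_assoc _ S]
    simp only [Matrix.mul_apply (N := S * σ x)]
    rw [(HasFDerivAt.fun_sum fun α _ =>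
      (hσ.differentiableAt_inv hU hy i α).hasFDerivAt.mul_const ((S * σ x) α l)).fderiv]
    simp [mul_comm]
  rw [prescribedSecond, h1]
  simp only [h2, mul_sub, Finset.sum_sub_distrib, Matrix.mul_apply (M := (σ y)⁻¹), neg_mul,
    Finset.sum_neg_distrib, ← sub_eq_add_neg]
  congr 1
  simp only [Finset.sum_mul, Finset.mul_sum, Matrix.mul_apply (M := pdForms σ _ y)]
  rw [Finset.sum_comm]
  exact Finset.sum_congr rfl fun α _ => Finset.sum_congr rfl fun m _ =>
    Finset.sum_congr rfl fun p _ => by ring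

theorem forms_mul_rhs (hσ : IsInvariantBasis C U σ) {x y : Coord} (hy : y ∈ U) :
    σ y * rhs σ S x y = S * σ x := by
  rw [rhs, Matrix.mul_assoc, Matrix.mul_nonsing_inv_cancel_left _ _ (hσ.isUnit_det hy)]

theorem IsInvariantBasis.prescribedSecond_sub (hσ : IsInvariantBasis C U σ) (hU : IsOpen U)
    {x y : Coord} (hx : x ∈ U) (hy : y ∈ U) (i k l : Fin 3) :
    prescribedSecond σ S i k l x y - prescribedSecond σ S i l k x y
      = 2 * ∑ α, ∑ ε, ∑ δ, (σ y)⁻¹ i α * σ x ε k * σ x δ l *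
          (∑ ρ, C ρ ε δ * S α ρ - ∑ μ, ∑ ν, C α μ ν * S μ ε * S ν δ) := by
  rw [hσ.prescribedSecond_eq hU hx hy, hσ.prescribedSecond_eq hU hx hy,
    ← Finset.sum_sub_distrib, Finset.mul_sum]
  refine Finset.sum_congr rfl fun α _ => ?_
  rw [← mul_sub]
  have e1 : ∑ ρ, S α ρ * pdForms σ k x ρ l - ∑ ρ, S α ρ * pdForms σ l x ρ k
      = ∑ ρ, S α ρ * (2 * ∑ β, ∑ γ, C ρ β γ * σ x γ l * σ x β k) := by
    rw [← Finset.sum_sub_distrib]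
    refine Finset.sum_congr rfl fun ρ _ => ?_
    rw [← hσ.structure_equation x hx, ← mul_sub]
    rfl
  have hS : ∀ β j, ∑ m, σ y β m * rhs σ S x y m j = ∑ ε, S β ε * σ x ε j := fun β j => by
    rw [← Matrix.mul_apply, forms_mul_rhs hσ hy, Matrix.mul_apply]
  have e2 : ∑ m, ∑ p, pdForms σ m y α p * rhs σ S x y p l * rhs σ S x y m k
        - ∑ m, ∑ p, pdForms σ m y α p * rhs σ S x y p k * rhs σ S x y m l
      = 2 * ∑ β, ∑ γ, C α β γ * (∑ ε, S β ε * σ x ε k) * ∑ δ, S γ δ * σ x δ l := by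
    simp only [← hS]
    -- Exchanging `m` and `p` in the second sum gives both sums the same `rhs` factors, so the curl
    -- of σ at `y` appears.
    rw [Finset.sum_comm (f := fun m p => pdForms σ m y α p * rhs σ S x y p k * rhs σ S x y m l),
      ← Finset.sum_sub_distrib]
    simp only [← Finset.sum_sub_distrib]
    have : ∀ m p, pdForms σ m y α p * rhs σ S x y p l * rhs σ S x y m k
        - pdForms σ p y α m * rhs σ S x y m k * rhs σ S x y p l
        = (2 * ∑ β, ∑ γ, C α β γ * σ y γ p * σ y β m) * (rhs σ S x y p l * rhs σ S x y m k) :=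
      fun m p => by
        rw [← hσ.structure_equation y hy]
        simp only [pdForms, Matrix.of_apply]
        ring
    simp only [this]
    generalize rhs σ S x y = R
    simp only [Fin.sum_univ_three]
    ring
  have e3 : ∀ A B A' B' : ℝ, A - B - (A' - B') = (A - A') - (B - B') := fun _ _ _ _ => by ring
  rw [e3, e1, e2]
  generalize σ x = X
  simp only [Fin.sum_univ_three]
  ring

end Bianchi

end

noncomputable section

open Set Metric Filter Topology

/-! ### Lie algebra automorphisms and local coordinate changes. -/

namespace Bianchi

variable {σ : Coord → Matrix (Fin 3) (Fin 3) ℝ} {S Λ : Matrix (Fin 3) (Fin 3) ℝ} {U : Set Coord}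
  {C : Fin 3 → Fin 3 → Fin 3 → ℝ}

/-- The matrix `L` preserves the structure constants `C`. -/
def PreservesStructure (C : Fin 3 → Fin 3 → Fin 3 → ℝ) (L : Matrix (Fin 3) (Fin 3) ℝ) : Prop :=
  ∀ α ε δ, ∑ ρ, C ρ ε δ * L α ρ = ∑ μ, ∑ ν, C α μ ν * L μ ε * L ν δ

section Algebra

variable {𝔤 : Type*} [LieRing 𝔤] [LieAlgebra ℝ 𝔤] (b : Module.Basis (Fin 3) ℝ 𝔤)

theorem lie_basis (β γ : Fin 3) : ⁅b β, b γ⁆ = ∑ α, structureConst b α β γ • b α :=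
  (b.sum_repr ⁅b β, b γ⁆).symm

/-- The two sides of `PreservesStructure` are the coordinates of the two brackets. -/
theorem preservesStructure_iff_lie (L : Matrix (Fin 3) (Fin 3) ℝ) (φ : 𝔤 →ₗ[ℝ] 𝔤)
    (hφ : ∀ μ, φ (b μ) = ∑ α, L α μ • b α) :
    PreservesStructure (structureConst b) L ↔ ∀ ε δ, φ ⁅b ε, b δ⁆ = ⁅φ (b ε), φ (b δ)⁆ := by
  have h1 : ∀ ε δ α, b.repr (φ ⁅b ε, b δ⁆) α = ∑ ρ, structureConst b ρ ε δ * L α ρ :=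
    fun ε δ α => by
      rw [lie_basis, map_sum, map_sum, Finsupp.finsetSum_apply]
      refine Finset.sum_congr rfl fun ρ _ => ?_
      simp [hφ, Finsupp.single_apply]
  have h2 : ∀ ε δ α, b.repr ⁅φ (b ε), φ (b δ)⁆ α
      = ∑ μ, ∑ ν, structureConst b α μ ν * L μ ε * L ν δ := fun ε δ α => by
    rw [hφ, hφ, sum_lie, map_sum, Finsupp.finsetSum_apply]
    refine Finset.sum_congr rfl fun μ _ => ?_
    rw [lie_sum, map_sum, Finsupp.finsetSum_apply]
    refine Finset.sum_congr rfl fun ν _ => ?_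
    simp only [smul_lie, lie_smul, map_smul, Finsupp.smul_apply, smul_eq_mul, structureConst]
    ring
  refine ⟨fun H ε δ => b.repr.injective (Finsupp.ext fun α => ?_), fun H α ε δ => ?_⟩
  · rw [h1, h2, H]
  · rw [← h1, ← h2, H]

theorem isLieAutomorphism_iff {L : Matrix (Fin 3) (Fin 3) ℝ} (hL : IsUnit L.det) :
    IsLieAutomorphism b L ↔ PreservesStructure (structureConst b) L := by
  constructor
  · rintro ⟨φ, hφ⟩
    exact (preservesStructure_iff_lie b L φ.toLinearEquiv.toLinearMap hφ).2
      fun ε δ => φ.map_lie _ _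
  · intro H
    let φ : 𝔤 ≃ₗ[ℝ] 𝔤 := L.toLinearEquiv b hL
    have hφ : ∀ μ, φ.toLinearMap (b μ) = ∑ α, L α μ • b α := fun μ => by
      simp [φ, Matrix.toLin_self]
    have h1 := (preservesStructure_iff_lie b L φ.toLinearMap hφ).1 H
    have h2 : ∀ x y, φ ⁅x, y⁆ = ⁅φ x, φ y⁆ := fun x y => by
      rw [← b.sum_repr x, ← b.sum_repr y]
      simp only [sum_lie, lie_sum, map_sum, smul_lie, lie_smul, map_smul]
      refine Finset.sum_congr rfl fun δ _ => congrArg _ (Finset.sum_congr rfl fun ε _ => ?_)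
      exact congrArg _ (h1 ε δ)
    exact ⟨{ φ with map_lie' := h2 _ _ }, hφ⟩

theorem IsLieAutomorphism.inv {L : Matrix (Fin 3) (Fin 3) ℝ} (hL : IsUnit L.det)
    (h : IsLieAutomorphism b L) : IsLieAutomorphism b L⁻¹ := by
  obtain ⟨φ, hφ⟩ := h
  refine ⟨φ.symm, fun μ => φ.injective ((φ.apply_symm_apply _).trans ?_)⟩
  change b μ = φ.toLinearEquiv.toLinearMap _
  rw [map_sum]
  have h1 : ∀ α, φ.toLinearEquiv.toLinearMap (L⁻¹ α μ • b α) = ∑ β, (L β α * L⁻¹ α μ) • b β :=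
    fun α => by
      rw [map_smul]
      change _ • φ (b α) = _
      rw [hφ, Finset.smul_sum]
      exact Finset.sum_congr rfl fun β _ => by rw [smul_smul, mul_comm]
  simp only [h1]
  rw [Finset.sum_comm]
  simp only [← Finset.sum_smul, ← Matrix.mul_apply, Matrix.mul_nonsing_inv _ hL, Matrix.one_apply]
  simp

end Algebra

theorem eq_zero_of_forall_sum_mul {A : Matrix (Fin 3) (Fin 3) ℝ} (hA : IsUnit A.det)
    {v : Fin 3 → ℝ} (h : ∀ i, ∑ α, A i α * v α = 0) (α : Fin 3) : v α = 0 :=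
  congrFun (Matrix.eq_zero_of_mulVec_eq_zero hA.ne_zero (funext h)) α

/-- One pair of points suffices: the tensor is constant, and the invertible matrices σ(x), σ(x),
σ(y)⁻¹ contracted with it are stripped off one index at a time. -/
theorem IsInvariantBasis.preservesStructure (hσ : IsInvariantBasis C U σ) (hU : IsOpen U)
    {x y : Coord} (hx : x ∈ U) (hy : y ∈ U)
    (H : ∀ i k l, prescribedSecond σ S i k l x y - prescribedSecond σ S i l k x y = 0) :
    PreservesStructure C S := by
  have hT : IsUnit ((σ y)⁻¹).det := Matrix.isUnit_nonsing_inv_det _ (hσ.isUnit_det hy)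
  have hX : IsUnit ((σ x).transpose).det := by rw [Matrix.det_transpose]; exact hσ.isUnit_det hx
  intro α ε δ
  rw [← sub_eq_zero]
  revert δ
  refine eq_zero_of_forall_sum_mul hX fun l => ?_
  revert ε
  refine eq_zero_of_forall_sum_mul hX fun k => ?_
  revert α
  refine eq_zero_of_forall_sum_mul hT fun i => ?_
  have := H i k l
  rw [hσ.prescribedSecond_sub hU hx hy, mul_eq_zero] at this
  rw [← this.resolve_left two_ne_zero]
  refine Finset.sum_congr rfl fun α _ => ?_
  rw [Finset.mul_sum]
  refine Finset.sum_congr rfl fun ε _ => ?_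
  rw [Finset.mul_sum, Finset.mul_sum]
  refine Finset.sum_congr rfl fun δ _ => ?_
  simp only [Matrix.transpose_apply]
  ring

theorem IsInvariantBasis.integrability (hσ : IsInvariantBasis C U σ) (hU : IsOpen U)
    (H : PreservesStructure C S) : Integrability U σ S := by
  intro x hx y hy i k l
  rw [hσ.prescribedSecond_sub hU hx hy]
  simp [H _ _ _]

theorem jacobian_eq {f : Coord → Coord} {f' : Coord →L[ℝ] Coord} {x : Coord}
    (hf : HasFDerivAt f f' x) : jacobian f x = LinearMap.toMatrix' (f' : Coord →ₗ[ℝ] Coord) := by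
  ext i j
  rw [jacobian, Matrix.of_apply, pd_coord hf, LinearMap.toMatrix'_apply]
  rfl

theorem solvesSystem_iff {V : Set Coord} {f : Coord → Coord} :
    SolvesSystem σ S V f ↔ ∀ x ∈ V, jacobian f x = rhs σ S x (f x) :=
  forall₂_congr fun _ _ => ⟨fun h => Matrix.ext h, fun h i j => congrFun (congrFun h i) j⟩

theorem IsCoordChange.differentiableAt {f : OpenPartialHomeomorph Coord Coord}
    (hf : IsCoordChange U f) {x : Coord} (hx : x ∈ f.source) : DifferentiableAt ℝ f x :=
  (hf.smooth.contDiffAt (f.open_source.mem_nhds hx)).differentiableAt (by simp)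

theorem IsCoordChange.jacobian_symm_mul {f : OpenPartialHomeomorph Coord Coord}
    (hf : IsCoordChange U f) {x : Coord} (hx : x ∈ f.source) :
    jacobian f.symm (f x) * jacobian f x = 1 := by
  have h1 := (hf.differentiableAt hx).hasFDerivAt
  have h2 : HasFDerivAt f.symm (fderiv ℝ f.symm (f x)) (f x) :=
    ((hf.smooth_symm.contDiffAt (f.open_target.mem_nhds (f.map_source hx))).differentiableAt
      (by simp)).hasFDerivAt
  have h3 : HasFDerivAt (f.symm ∘ f) (ContinuousLinearMap.id ℝ Coord) x := by
    refine (hasFDerivAt_id x).congr_of_eventuallyEq ?_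
    filter_upwards [f.open_source.mem_nhds hx] with z hz
    exact f.left_inv hz
  rw [jacobian_eq h1, jacobian_eq h2, ← LinearMap.toMatrix'_comp,
    ← ContinuousLinearMap.toLinearMap_comp, HasFDerivAt.unique (h2.comp x h1) h3]
  exact LinearMap.toMatrix'_id

/-- Since the Jacobians of `f` and `f.symm` are inverse to each other, both conditions amount to
σ(x) = Λ σ(f x) Df(x). -/
theorem IsCoordChange.mixesBy_iff (hσ : IsInvariantBasis C U σ)
    {f : OpenPartialHomeomorph Coord Coord} (hf : IsCoordChange U f) (hΛ : IsUnit Λ.det) :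
    MixesBy σ f Λ ↔ SolvesSystem σ Λ⁻¹ f.source f := by
  rw [solvesSystem_iff]
  have key : ∀ x ∈ f.source, transformed σ f (f x) = Λ * σ (f x) ↔
      jacobian f x = rhs σ Λ⁻¹ x (f x) := fun x hx => by
    have hy : IsUnit (σ (f x)).det := hσ.isUnit_det (hf.target_subset (f.map_source hx))
    have hJ := hf.jacobian_symm_mul hx
    have hJ' := mul_eq_one_comm.1 hJ
    rw [transformed, f.left_inv hx, rhs]
    constructor
    · intro h
      have h1 : σ x = Λ * σ (f x) * jacobian f x := by
        rw [← h, Matrix.mul_assoc, hJ, Matrix.mul_one]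
      rw [h1, Matrix.mul_assoc, Matrix.mul_assoc Λ, Matrix.nonsing_inv_mul_cancel_left _ _ hΛ,
        Matrix.nonsing_inv_mul_cancel_left _ _ hy]
    · intro h
      have h1 : σ x = Λ * σ (f x) * jacobian f x := by
        rw [h, Matrix.mul_assoc, Matrix.mul_assoc, Matrix.mul_nonsing_inv_cancel_left _ _ hy,
          Matrix.mul_nonsing_inv_cancel_left _ _ hΛ]
      rw [h1, Matrix.mul_assoc, hJ', Matrix.mul_one]
  constructor
  · exact fun h x hx => (key x hx).1 (h _ (f.map_source hx))
  · intro h y hy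
    have := (key _ (f.map_target hy)).2 (h _ (f.map_target hy))
    rwa [f.right_inv hy] at this

/-- The right-hand side of the system as an invertible linear map. -/
theorem IsInvariantBasis.exists_equiv_rhsCLM (hσ : IsInvariantBasis C U σ) (hS : IsUnit S.det)
    {x y : Coord} (hx : x ∈ U) (hy : y ∈ U) :
    ∃ e : Coord ≃L[ℝ] Coord, (e : Coord →L[ℝ] Coord) = rhsCLM σ S (x, y) := by
  have hdet : IsUnit (rhs σ S x y).det := by
    rw [rhs, Matrix.det_mul, Matrix.det_mul]
    exact ((Matrix.isUnit_nonsing_inv_det _ (hσ.isUnit_det hy)).mul hS).mul (hσ.isUnit_det hx)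
  refine ⟨((rhs σ S x y).toLinearEquiv' (Matrix.invertibleOfIsUnitDet _ hdet)
    ).toContinuousLinearEquiv, ?_⟩
  refine ContinuousLinearMap.ext fun v => funext fun i => ?_
  rw [rhsCLM_apply]
  rfl

/-- Integrability yields local coordinate changes solving the system, with any initial value. -/
theorem IsInvariantBasis.exists_coordChange (hσ : IsInvariantBasis C U σ) (hU : IsOpen U)
    (hS : IsUnit S.det) (H : Integrability U σ S) {x₀ y₀ : Coord} (hx₀ : x₀ ∈ U) (hy₀ : y₀ ∈ U) :
    ∃ f : OpenPartialHomeomorph Coord Coord,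
      IsCoordChange U f ∧ x₀ ∈ f.source ∧ f x₀ = y₀ ∧ SolvesSystem σ S f.source f := by
  have hnhds : U ×ˢ U ∈ 𝓝 (x₀, y₀) := prod_mem_nhds (hU.mem_nhds hx₀) (hU.mem_nhds hy₀)
  obtain ⟨f, hf₀, hf⟩ := TotalDifferential.exists_solution (x₀ := x₀) (y₀ := y₀)
    (((hσ.smooth_rhsCLM S).contDiffAt hnhds)|>.of_le (WithTop.coe_le_coe.2 le_top))
    (by
      filter_upwards [hnhds] with p hp
      exact (hσ.integrability_iff hU hp.1 hp.2).1 (H _ hp.1 _ hp.2))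
  have hfU : ∀ᶠ x in 𝓝 x₀, f x ∈ U :=
    hf.self_of_nhds.continuousAt.eventually (by rw [hf₀]; exact hU.mem_nhds hy₀)
  obtain ⟨V, hV, hVo, hxV⟩ := _root_.eventually_nhds_iff.1 (hf.and (hfU.and (hU.mem_nhds hx₀)))
  have hsm : ContDiffOn ℝ ∞ f V := TotalDifferential.contDiffOn_solution (hσ.smooth_rhsCLM S) hVo
    (fun x hx => (hV x hx).1) fun x hx => ⟨(hV x hx).2.2, (hV x hx).2.1⟩
  have hat : ∀ x ∈ V, ContDiffAt ℝ ∞ f x := fun x hx => hsm.contDiffAt (hVo.mem_nhds hx)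
  -- Invertibility at every point of `V`, not only at `x₀`, is what makes the inverse smooth on its
  -- whole domain.
  have hequiv : ∀ x ∈ V, ∃ e : Coord ≃L[ℝ] Coord, HasFDerivAt f (e : Coord →L[ℝ] Coord) x :=
    fun x hx => by
      obtain ⟨e, he⟩ := hσ.exists_equiv_rhsCLM hS (hV x hx).2.2 (hV x hx).2.1
      exact ⟨e, he ▸ (hV x hx).1⟩
  obtain ⟨e₀, he₀⟩ := hequiv x₀ hxV
  -- Restricting the local inverse to `V` keeps source and target in `U` and the equation valid
  -- throughout.
  let g := ((hat x₀ hxV).toOpenPartialHomeomorph f he₀ (by simp)).restrOpen V hVo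
  have hg : ∀ x, g x = f x := fun _ => rfl
  have hgV : g.source ⊆ V := fun x hx => hx.2
  have hsymm : ∀ y ∈ g.target, g.symm y ∈ V := fun y hy => hgV (g.map_target hy)
  refine ⟨g, ⟨fun x hx => (hV x (hgV hx)).2.2, fun y hy => ?_, hsm.mono hgV, fun y hy => ?_⟩,
    ⟨(hat x₀ hxV).mem_toOpenPartialHomeomorph_source he₀ _, hxV⟩, hf₀, fun x hx i j => ?_⟩
  · rw [← g.right_inv hy]
    exact (hV _ (hsymm y hy)).2.1
  · obtain ⟨e, he⟩ := hequiv _ (hsymm y hy)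
    exact (g.contDiffAt_symm hy he (hat _ (hsymm y hy))).contDiffWithinAt
  · exact (pd_coord (hV x (hgV hx)).1 i j).trans (rhsCLM_single _ i j)

theorem IsInvariantBasis.preservesStructure_of_solvesSystem (hσ : IsInvariantBasis C U σ)
    (hU : IsOpen U) {V : Set Coord} {f : Coord → Coord} (hV : IsOpen V) (hne : V.Nonempty)
    (hVU : V ⊆ U) (hm : MapsTo f V U) (hd : DifferentiableOn ℝ f V)
    (hf : SolvesSystem σ S V f) : PreservesStructure C S := by
  obtain ⟨x, hx⟩ := hne
  have hnhds : U ×ˢ U ∈ 𝓝 (x, f x) :=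
    prod_mem_nhds (hU.mem_nhds (hVU hx)) (hU.mem_nhds (hm hx))
  refine hσ.preservesStructure hU (hVU hx) (hm hx)
    ((hσ.integrability_iff hU (hVU hx) (hm hx)).2 fun v h => ?_)
  refine TotalDifferential.integrable_of_solution
    (((hσ.smooth_rhsCLM S).contDiffAt hnhds).differentiableAt (by simp)) ?_ v h
  filter_upwards [hV.mem_nhds hx] with z hz
  exact hf.hasFDerivAt hz (hd.differentiableAt (hV.mem_nhds hz))

end Bianchi

end

theorem mainTheorem3 {𝔤 : Type*} [LieRing 𝔤] [LieAlgebra ℝ 𝔤] (b : Module.Basis (Fin 3) ℝ 𝔤)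
    (U : Set Bianchi.Coord) (hU : IsOpen U) (hne : U.Nonempty)
    (σ : Bianchi.Coord → Matrix (Fin 3) (Fin 3) ℝ)
    (hσ : Bianchi.IsInvariantBasis (Bianchi.structureConst b) U σ)
    (Λ S : Matrix (Fin 3) (Fin 3) ℝ) (hΛ : IsUnit Λ.det) (hS : S = Λ⁻¹) :
    -- a coordinate change mixes the forms by `Λ` iff it solves the first-order system
    (∀ f : OpenPartialHomeomorph Bianchi.Coord Bianchi.Coord, Bianchi.IsCoordChange U f →
      (Bianchi.MixesBy σ f Λ ↔ Bianchi.SolvesSystem σ S f.source f)) ∧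
    -- the integrability condition of the system in explicit form
    (∀ x ∈ U, ∀ y ∈ U, ∀ i k l,
      Bianchi.prescribedSecond σ S i k l x y - Bianchi.prescribedSecond σ S i l k x y
        = 2 * ∑ α, ∑ ε, ∑ δ, (σ y)⁻¹ i α * σ x ε k * σ x δ l *
            (∑ ρ, Bianchi.structureConst b ρ ε δ * S α ρ
              - ∑ μ, ∑ ν, Bianchi.structureConst b α μ ν * S μ ε * S ν δ)) ∧
    -- existence of a solution, the integrability condition, and the automorphism property
    List.TFAE
      [∃ f : OpenPartialHomeomorph Bianchi.Coord Bianchi.Coord,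
          Bianchi.IsCoordChange U f ∧ f.source.Nonempty ∧ Bianchi.MixesBy σ f Λ,
        ∀ x₀ ∈ U, ∀ y₀ ∈ U, ∃ f : OpenPartialHomeomorph Bianchi.Coord Bianchi.Coord,
          Bianchi.IsCoordChange U f ∧ x₀ ∈ f.source ∧ f x₀ = y₀ ∧ Bianchi.MixesBy σ f Λ,
        ∃ (V : Set Bianchi.Coord) (f : Bianchi.Coord → Bianchi.Coord),
          IsOpen V ∧ V.Nonempty ∧ V ⊆ U ∧ Set.MapsTo f V U ∧ DifferentiableOn ℝ f V ∧
            Bianchi.SolvesSystem σ S V f,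
        Bianchi.Integrability U σ S,
        Bianchi.IsLieAutomorphism b S,
        Bianchi.IsLieAutomorphism b Λ,
        ∀ α μ ν, ∑ ρ, Bianchi.structureConst b ρ μ ν * Λ α ρ
          = ∑ κ, ∑ τ, Λ κ μ * Λ τ ν * Bianchi.structureConst b α κ τ] := by
  have hSdet : IsUnit S.det := hS ▸ Matrix.isUnit_nonsing_inv_det _ hΛ
  have hSinv : S⁻¹ = Λ := by rw [hS, Matrix.nonsing_inv_nonsing_inv _ hΛ]
  have hmix : ∀ f : OpenPartialHomeomorph Bianchi.Coord Bianchi.Coord, Bianchi.IsCoordChange U f →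
      (Bianchi.MixesBy σ f Λ ↔ Bianchi.SolvesSystem σ S f.source f) := fun f hf => by
    rw [hS]
    exact hf.mixesBy_iff hσ hΛ
  refine ⟨hmix, fun x hx y hy i k l => hσ.prescribedSecond_sub hU hx hy i k l, ?_⟩
  -- The cycle 1 → 3 → 5 → 4 → 2 → 1 passes from one local solution to all initial values through
  -- the point-free condition 5.
  tfae_have 1 → 3 := by
    rintro ⟨f, hf, hfne, hfm⟩
    exact ⟨f.source, f, f.open_source, hfne, hf.source_subset,
      fun x hx => hf.target_subset (f.map_source hx),
      fun x hx => (hf.differentiableAt hx).differentiableWithinAt, (hmix f hf).1 hfm⟩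
  tfae_have 3 → 5 := by
    rintro ⟨V, f, hV, hVne, hVU, hm, hd, hf⟩
    exact (Bianchi.isLieAutomorphism_iff b hSdet).2
      (hσ.preservesStructure_of_solvesSystem hU hV hVne hVU hm hd hf)
  tfae_have 5 → 4 := fun h =>
    hσ.integrability hU ((Bianchi.isLieAutomorphism_iff b hSdet).1 h)
  tfae_have 4 → 2 := by
    intro H x₀ hx₀ y₀ hy₀
    obtain ⟨f, hf, hx, hfx, hs⟩ := hσ.exists_coordChange hU hSdet H hx₀ hy₀
    exact ⟨f, hf, hx, hfx, (hmix f hf).2 hs⟩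
  tfae_have 2 → 1 := by
    intro H
    obtain ⟨x, hx⟩ := hne
    obtain ⟨f, hf, hxf, -, hm⟩ := H x hx x hx
    exact ⟨f, hf, ⟨x, hxf⟩, hm⟩
  tfae_have 5 → 6 := fun h => hSinv ▸ h.inv b hSdet
  tfae_have 6 → 5 := fun h => hS ▸ h.inv b hΛ
  tfae_have 6 ↔ 7 := by
    rw [Bianchi.isLieAutomorphism_iff b hΛ]
    refine forall₃_congr fun α μ ν => ?_
    have : ∀ κ τ, Bianchi.structureConst b α κ τ * Λ κ μ * Λ τ ν
        = Λ κ μ * Λ τ ν * Bianchi.structureConst b α κ τ := fun κ τ => by ring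
    simp only [this]
  tfae_finish
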